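/- Theorem (Growth rate of sublevel sets). Let $d\ge 1$, let $X\subseteq\mathbb R^d$ be measurable with $0\in X$, and let $V:X\to\mathbb R$ be Lipschitz and positive definite, i.e. $V(0)=0$ and $V(x)>0$ for $x\in X\setminus\{0\}$. Write $S_c=\{x\in X: V(x)\le c\}$, $\partial S_c=\{x\in X: V(x)=c\}$, let $\mu$ be Lebesgue measure and $\mathcal H^{d-1}$ the $(d-1)$-dimensional Hausdorff measure (surface measure, normalized to agree with Lebesgue measure on hyperplanes), and let $G>0$. Say that the growth bound holds at a level $c>0$ if $t\mapsto\mu(S_t)$ is differentiable at $c$ with $$\frac{d}{dc}\mu(S_c)\le G^{-1}\,\mathcal H^{d-1}(\partial S_c),$$ and, for every $\varepsilon>0$, all $\alpha>1$ sufficiently close to $1$ satisfy $$\mu(S_{\alpha c}\setminus S_c)\le c(\alpha-1)G^{-1}\bigl(\mathcal H^{d-1}(\partial S_c)+\varepsilon\bigr).$$ 1. Let $0\le a<b$ and suppose $\|\nabla V(x)\|\ge G$ for almost every $x\in S_b\setminus S_a$ (the gradient of a Lipschitz function exists almost everywhere; for $a=0$ this is the bound on the sublevel set $S_b$). Then for all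 $a\le s\le t\le b$ $$\mu(S_t\setminus S_s)\le G^{-1}\int_s^t\mathcal H^{d-1}(\partial S_r)\,dr,$$ and, if $\mu(S_b)<\infty$, the growth bound holds at almost every level $c\in(a,b)$. 2. Let $c>0$ be such that $S_{c'}$ is compact for some $c'>c$, every point of $\partial S_c$ is an interior point of $X$ near which $V$ is continuously differentiable, and $\|\nabla V\|\ge G$ on $\partial S_c$. Then $\mathcal H^{d-1}(\partial S_c)<\infty$ and the growth bound holds at the level $c$. If moreover $\|\nabla V\|=G$ on $\partial S_c$, then $\frac{d}{dc}\mu(S_c)=G^{-1}\mathcal H^{d-1}(\partial S_c)$. -/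

import Mathlib

open MeasureTheory Filter Topology
open scoped NNReal ENNReal Gradient

noncomputable section

/-- `V` is positive definite on `X`: `V 0 = 0` and `V > 0` on `X \ {0}`. -/
def PosDefOn {d : ℕ} (X : Set (EuclideanSpace ℝ (Fin d))) (V : EuclideanSpace ℝ (Fin d) → ℝ) :
    Prop :=
  (0 : EuclideanSpace ℝ (Fin d)) ∈ X ∧ V 0 = 0 ∧ ∀ x ∈ X, x ≠ 0 → 0 < V x

/-- The sublevel set `S_c(V) = {x ∈ X : V x ≤ c}`. -/
def subLevel {d : ℕ} (X : Set (EuclideanSpace ℝ (Fin d))) (V : EuclideanSpace ℝ (Fin d) → ℝ)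
    (c : ℝ) : Set (EuclideanSpace ℝ (Fin d)) :=
  {x | x ∈ X ∧ V x ≤ c}

/-- The level set `∂S_c(V) = {x ∈ X : V x = c}`. -/
def levelSurface {d : ℕ} (X : Set (EuclideanSpace ℝ (Fin d)))
    (V : EuclideanSpace ℝ (Fin d) → ℝ) (c : ℝ) : Set (EuclideanSpace ℝ (Fin d)) :=
  {x | x ∈ X ∧ V x = c}

/-- Surface measure of the level set `∂S_c(V)`: its `(d-1)`-dimensional Hausdorff measure, in the
normalization that agrees with Lebesgue measure on Euclidean spaces of dimension `d - 1`. -/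
def surfaceArea {d : ℕ} (X : Set (EuclideanSpace ℝ (Fin d)))
    (V : EuclideanSpace ℝ (Fin d) → ℝ) (c : ℝ) : ℝ≥0∞ :=
  μHE[d - 1] (levelSurface X V c)

/-- At the level `c` the volume of the sublevel sets grows at a rate of at most `G⁻¹` times the
surface measure of the level set: the derivative of `t ↦ μ(S_t(V))` at `c` exists and is bounded by
that number, and, to first order as `α` decreases to `1`, the volume of the gap
`S_{αc}(V) \ S_c(V)` is at most `c (α - 1) G⁻¹` times the surface measure. -/
def GrowthBoundAt {d : ℕ} (X : Set (EuclideanSpace ℝ (Fin d)))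
    (V : EuclideanSpace ℝ (Fin d) → ℝ) (G c : ℝ) : Prop :=
  (∃ ρ : ℝ, HasDerivAt (fun t => volume.real (subLevel X V t)) ρ c ∧
    ENNReal.ofReal ρ ≤ ENNReal.ofReal G⁻¹ * surfaceArea X V c) ∧
  ∀ ε : ℝ, 0 < ε → ∀ᶠ α in 𝓝[>] (1 : ℝ),
    volume (subLevel X V (α * c) \ subLevel X V c) ≤
      ENNReal.ofReal (c * (α - 1) * G⁻¹) * (surfaceArea X V c + ENNReal.ofReal ε)

end

/-!
If the increments of `V` on a set are those of a linear form `⟪g, ·⟫` with `g ≠ 0` up to a small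
relative error, then moving the points of the set along `g` carries the level sets of `V` into
hyperplanes and distorts distances by a factor close to `1`. By Fubini's theorem for these
hyperplanes, the volume of the set is `‖g‖⁻¹` times the integral over all levels of the area of its
level sets, up to such a factor.

A measurable set at whose points `V` has a nonzero gradient splits into countably many sets of this
kind; with distortion tending to `1` this gives the coarea inequality, that is, a bound on the image
of the volume under `V` by a measure with density `G⁻¹` times the surface area. The derivative of
the volume of the sublevel sets is almost everywhere the density of this image measure.

On the level set of a regular value a partition of unity replaces the countable partition. The
integral of a continuous function of compact support over a hyperplane depends continuously on the
level, so in the limit of no distortion the derivative of the volume exists at this very level, and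
it is the integral of `‖∇V‖⁻¹` over the level set.
-/

section GrowthOfSublevelSets

open Module Measure
open scoped RealInnerProductSpace

section Hyperplanes

variable {E : Type*} [NormedAddCommGroup E] [InnerProductSpace ℝ E] {g : E}

/-- The vector orthogonal to the level sets of the linear form `⟪g, ·⟫` along which this form
increases by `1`. -/
noncomputable def levelStep (g : E) : E := (‖g‖ ^ 2)⁻¹ • g

theorem inner_levelStep (hg : g ≠ 0) : ⟪g, levelStep g⟫ = 1 := by
  rw [levelStep, real_inner_smul_right, real_inner_self_eq_norm_sq]
  exact inv_mul_cancel₀ (by simpa using hg)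

theorem levelStep_ne_zero (hg : g ≠ 0) : levelStep g ≠ 0 :=
  smul_ne_zero (inv_ne_zero (by simpa using hg)) hg

theorem norm_levelStep (g : E) : ‖levelStep g‖ = ‖g‖⁻¹ := by
  rw [levelStep, norm_smul, norm_inv, norm_pow, norm_norm, sq, mul_inv]
  grind

theorem enorm_levelStep (hg : g ≠ 0) : ‖levelStep g‖ₑ = ‖g‖ₑ⁻¹ := by
  rw [← ofReal_norm, norm_levelStep, ENNReal.ofReal_inv_of_pos (norm_pos_iff.2 hg), ofReal_norm]

theorem mem_orthogonal_span_levelStep (hg : g ≠ 0) {z : E} :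
    z ∈ (ℝ ∙ levelStep g)ᗮ ↔ ⟪g, z⟫ = 0 := by
  rw [Submodule.mem_orthogonal_singleton_iff_inner_right, levelStep, real_inner_smul_left,
    mul_eq_zero_iff_left (inv_ne_zero (by simpa using hg))]

theorem range_orthogonal_add_smul_levelStep (hg : g ≠ 0) (r : ℝ) :
    Set.range (fun z : (ℝ ∙ levelStep g)ᗮ => (z : E) + r • levelStep g) = {y | ⟪g, y⟫ = r} := by
  ext y
  constructor
  · rintro ⟨z, rfl⟩
    have hz : ⟪g, (z : E)⟫ = 0 := (mem_orthogonal_span_levelStep hg).1 z.2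
    rw [Set.mem_ofPred_eq, inner_add_right, real_inner_smul_right, inner_levelStep hg, hz]
    ring
  · intro (hy : ⟪g, y⟫ = r)
    refine ⟨⟨y - r • levelStep g, (mem_orthogonal_span_levelStep hg).2 ?_⟩, by simp⟩
    rw [inner_sub_right, real_inner_smul_right, inner_levelStep hg, hy]
    ring

variable [MeasurableSpace E] [BorelSpace E]

theorem volume_span_singleton_eq_smul_map {v : E} (hv : v ≠ 0) :
    (volume : Measure (ℝ ∙ v)) =
      ‖v‖ₑ • (volume : Measure ℝ).map (ContinuousLinearEquiv.toSpanNonzeroSingleton ℝ v hv) :=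
  volume_eq_of_finrank_eq_one (v := (⟨v, Submodule.mem_span_singleton_self v⟩ : ℝ ∙ v))
    (finrank_span_singleton hv) (by simpa using hv)

variable [FiniteDimensional ℝ E] {f : E → ℝ≥0∞}

theorem lintegral_eq_lintegral_orthogonal_slices {v : E} (hv : v ≠ 0) (hf : Measurable f) :
    ∫⁻ y, f y ∂μHE[finrank ℝ E] = ‖v‖ₑ * ∫⁻ r : ℝ, ∫⁻ z : (ℝ ∙ v)ᗮ, f (z + r • v) := by
  have hprod : ∀ q : (ℝ ∙ v) × (ℝ ∙ v)ᗮ,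
      f (((ℝ ∙ v).measurableEquivProd (0 : E)).symm q) = f ((q.1 : E) + q.2) := by
    simp
  have hline : MeasurableEmbedding (ContinuousLinearEquiv.toSpanNonzeroSingleton ℝ v hv) :=
    (ContinuousLinearEquiv.toSpanNonzeroSingleton ℝ v hv).toHomeomorph.measurableEmbedding
  rw [← ((ℝ ∙ v).measurePreserving_measurableEquivProd (0 : E)).symm.lintegral_comp hf]
  simp_rw [hprod]
  rw [volume_eq_prod, lintegral_prod _ (by fun_prop), volume_span_singleton_eq_smul_map hv,
    lintegral_smul_measure, hline.lintegral_map, smul_eq_mul]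
  simp_rw [add_comm _ (_ : E)]
  rfl

theorem setLIntegral_hyperplane (hg : g ≠ 0) (r : ℝ) (hf : Measurable f) :
    ∫⁻ y in {y | ⟪g, y⟫ = r}, f y ∂μHE[finrank ℝ E - 1] =
      ∫⁻ z : (ℝ ∙ levelStep g)ᗮ, f (z + r • levelStep g) := by
  have hiso : Isometry (fun z : (ℝ ∙ levelStep g)ᗮ => (z : E) + r • levelStep g) :=
    (isometry_add_right _).comp isometry_subtype_coe
  have hrank : finrank ℝ (ℝ ∙ levelStep g)ᗮ = finrank ℝ E - 1 := by
    rw [← (ℝ ∙ levelStep g).finrank_add_finrank_orthogonal,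
      finrank_span_singleton (levelStep_ne_zero hg), Nat.add_sub_cancel_left]
  rw [← range_orthogonal_add_smul_levelStep hg r, ← hiso.map_euclideanHausdorffMeasure,
    lintegral_map hf hiso.continuous.measurable, ← hrank,
    InnerProductSpace.euclideanHausdorffMeasure_eq_volume]

theorem lintegral_eq_lintegral_hyperplane (hg : g ≠ 0) (hf : Measurable f) :
    ∫⁻ y, f y ∂μHE[finrank ℝ E] =
      ‖g‖ₑ⁻¹ * ∫⁻ r : ℝ, ∫⁻ y in {y | ⟪g, y⟫ = r}, f y ∂μHE[finrank ℝ E - 1] := by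
  simp_rw [setLIntegral_hyperplane hg _ hf]
  rw [lintegral_eq_lintegral_orthogonal_slices (levelStep_ne_zero hg) hf, enorm_levelStep hg]

theorem setLIntegral_slab_eq_lintegral_hyperplane (hg : g ≠ 0) {S : Set E} (hS : MeasurableSet S)
    {B : Set ℝ} (hB : MeasurableSet B) (hf : Measurable f) :
    ∫⁻ y in S ∩ {y | ⟪g, y⟫ ∈ B}, f y ∂μHE[finrank ℝ E] =
      ‖g‖ₑ⁻¹ * ∫⁻ r in B, ∫⁻ y in S ∩ {y | ⟪g, y⟫ = r}, f y ∂μHE[finrank ℝ E - 1] := by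
  have hinner : Measurable fun y : E => ⟪g, y⟫ := by fun_prop
  have hslab : MeasurableSet {y : E | ⟪g, y⟫ ∈ B} := hinner hB
  rw [← lintegral_indicator (hS.inter hslab), ← lintegral_indicator hB,
    lintegral_eq_lintegral_hyperplane hg (hf.indicator (hS.inter hslab))]
  congr 2 with r
  rw [setLIntegral_indicator (hS.inter hslab)]
  by_cases hr : r ∈ B
  · rw [Set.indicator_of_mem hr]
    congr 2
    ext y
    simp only [Set.mem_inter_iff, Set.mem_ofPred_eq]
    grind
  · have hempty : S ∩ {y | ⟪g, y⟫ ∈ B} ∩ {y | ⟪g, y⟫ = r} = ∅ := by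
      ext y
      simp only [Set.mem_inter_iff, Set.mem_ofPred_eq]
      grind
    rw [Set.indicator_of_notMem hr, hempty, Measure.restrict_empty, lintegral_zero_measure]

theorem exists_continuous_setLIntegral_hyperplane (hg : g ≠ 0) {φ : E → ℝ≥0} (hφ : Continuous φ)
    (hφs : HasCompactSupport φ) :
    ∃ m : ℝ → ℝ≥0, Continuous m ∧
      ∀ r, ∫⁻ y in {y | ⟪g, y⟫ = r}, φ y ∂μHE[finrank ℝ E - 1] = m r := by
  let P := (ℝ ∙ levelStep g)ᗮ.orthogonalProjectionOnto
  have hk : IsCompact (P '' tsupport φ) := hφs.isCompact.image P.continuous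
  have hzero : ∀ (r : ℝ) (z : (ℝ ∙ levelStep g)ᗮ), z ∉ P '' tsupport φ →
      φ (z + r • levelStep g) = 0 := by
    intro r z hz
    by_contra hne
    refine hz ⟨z + r • levelStep g, subset_tsupport _ hne, ?_⟩
    simp [P, Submodule.orthogonalProjectionOnto_orthogonalComplement_singleton_eq_zero]
  have hcont : ∀ r : ℝ, Continuous fun z : (ℝ ∙ levelStep g)ᗮ => (φ (z + r • levelStep g) : ℝ) :=
    fun r => by fun_prop
  have hint : ∀ r : ℝ, Integrable fun z : (ℝ ∙ levelStep g)ᗮ => (φ (z + r • levelStep g) : ℝ) :=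
    fun r => (hcont r).integrable_of_hasCompactSupport
      (HasCompactSupport.intro hk fun z hz => by simp [hzero r z hz])
  refine ⟨fun r => (∫ z : (ℝ ∙ levelStep g)ᗮ, (φ (z + r • levelStep g) : ℝ)).toNNReal,
    continuous_real_toNNReal.comp (continuousOn_univ.1 ?_), fun r => ?_⟩
  · refine continuousOn_integral_of_compact_support hk (Continuous.continuousOn (by fun_prop)) ?_
    exact fun r z _ hz => by simp [hzero r z hz]
  · rw [setLIntegral_hyperplane hg r (by fun_prop), lintegral_coe_eq_integral _ (hint r)]
    rfl

end Hyperplanes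

section EqUpTo

/-- The two numbers `a` and `b` agree up to a factor of at most `κ`. -/
def EqUpTo (κ : ℝ≥0) (a b : ℝ≥0∞) : Prop := a ≤ κ * b ∧ b ≤ κ * a

namespace EqUpTo

variable {κ κ' : ℝ≥0} {a b c : ℝ≥0∞}

theorem trans (hab : EqUpTo κ a b) (hbc : EqUpTo κ' b c) : EqUpTo (κ * κ') a c := by
  rw [EqUpTo, ENNReal.coe_mul]
  constructor
  · calc a ≤ κ * b := hab.1
      _ ≤ κ * (κ' * c) := by gcongr; exact hbc.1
      _ = κ * κ' * c := (mul_assoc _ _ _).symm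
  · calc c ≤ κ' * b := hbc.2
      _ ≤ κ' * (κ * a) := by gcongr; exact hab.2
      _ = κ * κ' * a := by ring

theorem mul_left (h : EqUpTo κ a b) (c : ℝ≥0∞) : EqUpTo κ (c * a) (c * b) := by
  constructor <;> rw [mul_left_comm] <;> gcongr
  exacts [h.1, h.2]

theorem div_right (h : EqUpTo κ a b) (c : ℝ≥0∞) : EqUpTo κ (a / c) (b / c) := by
  simpa only [ENNReal.div_eq_inv_mul] using h.mul_left c⁻¹

theorem inv (hκ : κ ≠ 0) (h : EqUpTo κ a b) : EqUpTo κ a⁻¹ b⁻¹ := by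
  have inv_le : ∀ {x y : ℝ≥0∞}, y ≤ κ * x → x⁻¹ ≤ κ * y⁻¹ := fun {x y} hyx => by
    have hκ' : (κ : ℝ≥0∞) ≠ 0 := ENNReal.coe_ne_zero.2 hκ
    have hinv := ENNReal.inv_le_inv.2 hyx
    rwa [ENNReal.mul_inv (Or.inl hκ') (Or.inl ENNReal.coe_ne_top),
      ENNReal.inv_mul_le_iff hκ' ENNReal.coe_ne_top] at hinv
  exact ⟨inv_le h.2, inv_le h.1⟩

theorem sum {ι : Type*} {s : Finset ι} {u v : ι → ℝ≥0∞} (h : ∀ i ∈ s, EqUpTo κ (u i) (v i)) :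
    EqUpTo κ (∑ i ∈ s, u i) (∑ i ∈ s, v i) := by
  constructor <;> rw [Finset.mul_sum]
  exacts [Finset.sum_le_sum fun i hi => (h i hi).1, Finset.sum_le_sum fun i hi => (h i hi).2]

theorem setLIntegral {α : Type*} [MeasurableSpace α] {μ : Measure α} {s : Set α}
    (hs : MeasurableSet s) {u v : α → ℝ≥0∞} (h : ∀ x ∈ s, EqUpTo κ (u x) (v x)) :
    EqUpTo κ (∫⁻ x in s, u x ∂μ) (∫⁻ x in s, v x ∂μ) := by
  constructor <;> rw [← lintegral_const_mul' _ _ ENNReal.coe_ne_top]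
  exacts [setLIntegral_mono' hs fun x hx => (h x hx).1,
    setLIntegral_mono' hs fun x hx => (h x hx).2]

theorem lintegral_of_measure {α : Type*} [MeasurableSpace α] {μ ν : Measure α}
    (h : ∀ B, MeasurableSet B → EqUpTo κ (μ B) (ν B)) (f : α → ℝ≥0∞) :
    EqUpTo κ (∫⁻ x, f x ∂μ) (∫⁻ x, f x ∂ν) := by
  constructor <;> rw [← smul_eq_mul, ← lintegral_smul_measure]
  exacts [lintegral_mono' (Measure.le_iff.2 fun B hB => (h B hB).1) le_rfl,
    lintegral_mono' (Measure.le_iff.2 fun B hB => (h B hB).2) le_rfl]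

end EqUpTo

theorem le_of_forall_one_lt_le_pow_mul {a b : ℝ≥0∞} (N : ℕ)
    (h : ∀ κ : ℝ≥0, 1 < κ → a ≤ (κ : ℝ≥0∞) ^ N * b) : a ≤ b := by
  have hpow : Tendsto (fun κ : ℝ≥0 => ((κ ^ N : ℝ≥0) : ℝ≥0∞)) (𝓝[>] 1) (𝓝 1) := by
    have hcont : Continuous fun κ : ℝ≥0 => ((κ ^ N : ℝ≥0) : ℝ≥0∞) := by fun_prop
    simpa using (hcont.tendsto 1).mono_left nhdsWithin_le_nhds
  have hlim := ENNReal.Tendsto.mul_const (b := b) hpow (Or.inl one_ne_zero)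
  rw [one_mul] at hlim
  exact ge_of_tendsto hlim (eventually_nhdsWithin_of_forall fun κ hκ => by simpa using h κ hκ)

/-- Up to a factor of at most `κ`, the function `R` converges along `l` to `J`: it agrees up to this
factor with a function that has a finite limit, and so do `J` and that limit. -/
def TendstoUpTo {α : Type*} (κ : ℝ≥0) (R : α → ℝ≥0∞) (l : Filter α) (J : ℝ≥0∞) : Prop :=
  ∃ (R' : α → ℝ≥0∞) (L : ℝ≥0),
    Tendsto R' l (𝓝 L) ∧ (∀ᶠ t in l, EqUpTo κ (R t) (R' t)) ∧ EqUpTo κ J L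

namespace TendstoUpTo

variable {α : Type*} {κ : ℝ≥0} {R : α → ℝ≥0∞} {l : Filter α} {J : ℝ≥0∞}

theorem ne_top (h : TendstoUpTo κ R l J) : J ≠ ∞ := by
  obtain ⟨-, L, -, -, hJL⟩ := h
  exact ne_top_of_le_ne_top (by finiteness) hJL.1

theorem congr {R' : α → ℝ≥0∞} (h : TendstoUpTo κ R l J) (hR : R =ᶠ[l] R') :
    TendstoUpTo κ R' l J := by
  obtain ⟨Q, L, hQ, hRQ, hJL⟩ := h
  refine ⟨Q, L, hQ, ?_, hJL⟩
  filter_upwards [hR, hRQ] with t ht htQ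
  rwa [← ht]

theorem sum {ι : Type*} {s : Finset ι} {R : ι → α → ℝ≥0∞} {J : ι → ℝ≥0∞}
    (h : ∀ i ∈ s, TendstoUpTo κ (R i) l (J i)) :
    TendstoUpTo κ (fun t => ∑ i ∈ s, R i t) l (∑ i ∈ s, J i) := by
  choose! R' L hR' hRR' hJL using h
  refine ⟨fun t => ∑ i ∈ s, R' i t, ∑ i ∈ s, L i, ?_, ?_, ?_⟩
  · rw [ENNReal.ofNNReal_finsetSum]
    exact tendsto_finsetSum s hR'
  · filter_upwards [s.eventually_all.2 hRR'] with t ht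
    exact EqUpTo.sum ht
  · rw [ENNReal.ofNNReal_finsetSum]
    exact EqUpTo.sum hJL

theorem limsup_le [l.NeBot] (h : TendstoUpTo κ R l J) : limsup R l ≤ (κ : ℝ≥0∞) ^ 2 * J := by
  obtain ⟨R', L, hR', hRR', hJL⟩ := h
  have hlim : Tendsto (fun t => κ * R' t) l (𝓝 (κ * L)) :=
    ENNReal.Tendsto.const_mul hR' (Or.inr ENNReal.coe_ne_top)
  calc limsup R l ≤ limsup (fun t => κ * R' t) l := limsup_le_limsup (hRR'.mono fun _ ht => ht.1)
    _ = κ * L := hlim.limsup_eq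
    _ ≤ κ * (κ * J) := by gcongr; exact hJL.2
    _ = _ := by ring

theorem le_liminf [l.NeBot] (h : TendstoUpTo κ R l J) : J ≤ (κ : ℝ≥0∞) ^ 2 * liminf R l := by
  obtain ⟨R', L, hR', hRR', hJL⟩ := h
  calc J ≤ κ * L := hJL.1
    _ = κ * liminf R' l := by rw [hR'.liminf_eq]
    _ ≤ κ * liminf (fun t => κ * R t) l := by
        gcongr
        exact liminf_le_liminf (hRR'.mono fun _ ht => ht.2)
    _ = κ * (κ * liminf R l) := by
        rw [ENNReal.liminf_const_mul_of_ne_top ENNReal.coe_ne_top]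
    _ = _ := by ring

end TendstoUpTo

theorem tendsto_of_forall_tendstoUpTo_pow {α : Type*} {R : α → ℝ≥0∞} {l : Filter α} [l.NeBot]
    {J : ℝ≥0∞} (N : ℕ) (h : ∀ κ : ℝ≥0, 1 < κ → TendstoUpTo (κ ^ N) R l J) :
    Tendsto R l (𝓝 J) := by
  refine tendsto_of_le_liminf_of_limsup_le
    (le_of_forall_one_lt_le_pow_mul (N * 2) fun κ hκ => ?_)
    (le_of_forall_one_lt_le_pow_mul (N * 2) fun κ hκ => ?_)
  · simpa [pow_mul] using (h κ hκ).le_liminf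
  · simpa [pow_mul] using (h κ hκ).limsup_le

end EqUpTo

/-- The map `Φ` distorts distances on `D` by a factor of at most `κ`. -/
structure BiLipschitzOn {X Y : Type*} [PseudoEMetricSpace X] [PseudoEMetricSpace Y]
    (κ : ℝ≥0) (Φ : X → Y) (D : Set X) : Prop where
  lipschitzOnWith : LipschitzOnWith κ Φ D
  antilipschitzWith : AntilipschitzWith κ (D.domRestrict Φ)

namespace BiLipschitzOn

theorem mono {X Y : Type*} [PseudoEMetricSpace X] [PseudoEMetricSpace Y] {κ : ℝ≥0} {Φ : X → Y}
    {D D' : Set X} (h : BiLipschitzOn κ Φ D) (hD : D' ⊆ D) : BiLipschitzOn κ Φ D' :=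
  ⟨h.1.mono hD, fun x y => h.2 ⟨x, hD x.2⟩ ⟨y, hD y.2⟩⟩

theorem injOn {X Y : Type*} [EMetricSpace X] [PseudoEMetricSpace Y] {κ : ℝ≥0} {Φ : X → Y}
    {D : Set X} (h : BiLipschitzOn κ Φ D) : Set.InjOn Φ D :=
  Set.injOn_iff_injective.2 h.2.injective

variable {X Y : Type*} [EMetricSpace X] [EMetricSpace Y] {κ : ℝ≥0} {Φ : X → Y} {D : Set X}
  [MeasurableSpace X] [BorelSpace X] [MeasurableSpace Y] [BorelSpace Y]

theorem eqUpTo_euclideanHausdorffMeasure_image (h : BiLipschitzOn κ Φ D) (k : ℕ) :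
    EqUpTo (κ ^ k) (μHE[k] D) (μHE[k] (Φ '' D)) := by
  have hle := h.1.hausdorffMeasure_image_le (d := k) (by positivity)
  have hge := h.2.le_hausdorffMeasure_image (d := k) (by positivity) Set.univ
  rw [← isometry_subtype_coe.hausdorffMeasure_image (Or.inl (by positivity)), Set.image_univ,
    Set.image_univ, Subtype.range_coe, Set.range_domRestrict] at hge
  rw [ENNReal.rpow_natCast, ← ENNReal.coe_pow] at hle hge
  simp only [EqUpTo, euclideanHausdorffMeasure_def, Measure.smul_apply, mul_smul_comm]
  exact ⟨by gcongr, by gcongr⟩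

theorem eqUpTo_setLIntegral_image (h : BiLipschitzOn κ Φ D) (hD : MeasurableSet D) (k : ℕ)
    {f : Y → ℝ≥0∞} (hf : Measurable f) :
    EqUpTo (κ ^ k) (∫⁻ x in D, f (Φ x) ∂μHE[k]) (∫⁻ y in Φ '' D, f y ∂μHE[k]) := by
  have hΦ : AEMeasurable Φ (μHE[k].restrict D) := h.1.continuousOn.aemeasurable hD
  rw [← lintegral_map' hf.aemeasurable hΦ]
  refine EqUpTo.lintegral_of_measure (fun B hB => ?_) f
  rw [Measure.map_apply_of_aemeasurable hΦ hB, Measure.restrict_apply' hD,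
    Measure.restrict_apply hB, Set.inter_comm, Set.inter_comm B, ← Set.image_inter_preimage]
  exact (h.mono Set.inter_subset_left).eqUpTo_euclideanHausdorffMeasure_image k

end BiLipschitzOn

theorem measurableSet_inter_preimage_of_continuousOn {X Y : Type*} [TopologicalSpace X]
    [MeasurableSpace X] [OpensMeasurableSpace X] [TopologicalSpace Y] [MeasurableSpace Y]
    [BorelSpace Y] {f : X → Y} {s : Set X} (hf : ContinuousOn f s) (hs : MeasurableSet s)
    {B : Set Y} (hB : MeasurableSet B) : MeasurableSet (s ∩ f ⁻¹' B) := by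
  rw [← Subtype.image_preimage_coe]
  exact hs.subtype_image ((continuousOn_iff_continuous_domRestrict.1 hf).measurable hB)

section AlmostLinear

variable {E : Type*} [NormedAddCommGroup E] [InnerProductSpace ℝ E] {V : E → ℝ} {g : E}

/-- The map that moves each point in the direction of `g` so as to carry the level sets of `V` into
those of the linear form `⟪g, ·⟫`. -/
noncomputable def straighten (V : E → ℝ) (g x : E) : E :=
  x + (V x - ⟪g, x⟫) • levelStep g

theorem inner_straighten (hg : g ≠ 0) (x : E) : ⟪g, straighten V g x⟫ = V x := by
  rw [straighten, inner_add_right, real_inner_smul_right, inner_levelStep hg]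
  ring

theorem image_straighten_inter_preimage (hg : g ≠ 0) (D : Set E) (B : Set ℝ) :
    straighten V g '' (D ∩ V ⁻¹' B) = straighten V g '' D ∩ {y | ⟪g, y⟫ ∈ B} := by
  rw [← Set.image_inter_preimage]
  simp only [Set.preimage_ofPred_eq, inner_straighten hg]
  rfl

variable [CompleteSpace E] {κ : ℝ≥0} {D : Set E}

/-- On `D`, the increments of `V` are those of the linear form `⟪g, ·⟫` with `g ≠ 0`, up to the
relative error `1 - κ⁻¹`. The error is chosen so that `straighten V g` distorts distances by a
factor of at most `κ`. -/
structure AlmostLinearOn (κ : ℝ≥0) (V : E → ℝ) (g : E) (D : Set E) : Prop where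
  one_le : 1 ≤ κ
  ne_zero : g ≠ 0
  approximatesLinearOn :
    ApproximatesLinearOn V (InnerProductSpace.toDual ℝ E g) D ((1 - κ⁻¹) * ‖g‖₊)

theorem one_add_one_sub_inv_le (hκ : 1 ≤ κ) : 1 + (1 - κ⁻¹) ≤ κ := by
  have hκ' : (κ : ℝ) ≠ 0 := NNReal.coe_ne_zero.2 (zero_lt_one.trans_le hκ).ne'
  rw [← NNReal.coe_le_coe, NNReal.coe_add, NNReal.coe_sub (inv_le_one_of_one_le₀ hκ),
    NNReal.coe_one, NNReal.coe_inv]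
  have hsq : (κ : ℝ) - (1 + (1 - (κ : ℝ)⁻¹)) = (κ - 1) ^ 2 * (κ : ℝ)⁻¹ := by
    field_simp [hκ']
    ring
  rw [← sub_nonneg, hsq]
  positivity

namespace AlmostLinearOn

theorem approximatesLinearOn_straighten (h : AlmostLinearOn κ V g D) :
    ApproximatesLinearOn (straighten V g) (ContinuousLinearEquiv.refl ℝ E : E →L[ℝ] E) D
      (1 - κ⁻¹) := by
  intro x hx y hy
  have hg : ‖g‖ ≠ 0 := norm_ne_zero_iff.2 h.ne_zero
  have hdiff : straighten V g x - straighten V g y - (x - y) =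
      (V x - V y - ⟪g, x - y⟫) • levelStep g := by
    simp only [straighten, sub_smul, inner_sub_right]
    abel
  calc ‖straighten V g x - straighten V g y - (x - y)‖
      = ‖V x - V y - ⟪g, x - y⟫‖ * ‖g‖⁻¹ := by rw [hdiff, norm_smul, norm_levelStep]
    _ ≤ ((1 - κ⁻¹ : ℝ≥0) * ‖g‖ * ‖x - y‖) * ‖g‖⁻¹ := by
        gcongr
        simpa using h.approximatesLinearOn x hx y hy
    _ = (1 - κ⁻¹ : ℝ≥0) * ‖x - y‖ := by field_simp

theorem one_sub_inv_lt_inv_nnnorm_refl (h : AlmostLinearOn κ V g D) :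
    1 - κ⁻¹ < ‖((ContinuousLinearEquiv.refl ℝ E).symm : E →L[ℝ] E)‖₊⁻¹ := by
  have : Nontrivial E := ⟨⟨g, 0, h.ne_zero⟩⟩
  have hκ : 0 < κ⁻¹ := inv_pos.2 (zero_lt_one.trans_le h.one_le)
  simpa using tsub_lt_self zero_lt_one hκ

theorem biLipschitzOn_straighten (h : AlmostLinearOn κ V g D) :
    BiLipschitzOn κ (straighten V g) D := by
  have : Nontrivial E := ⟨⟨g, 0, h.ne_zero⟩⟩
  have happ := h.approximatesLinearOn_straighten
  constructor
  · refine (lipschitzOnWith_iff_restrict.2 happ.lipschitz).weaken ?_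
    simpa using one_add_one_sub_inv_le h.one_le
  · have hanti := happ.antilipschitz (Or.inr h.one_sub_inv_lt_inv_nnnorm_refl)
    simpa [tsub_tsub_cancel_of_le (inv_le_one_of_one_le₀ h.one_le)] using hanti

theorem eqUpTo_enorm_gradient (h : AlmostLinearOn κ V g D) {x : E} (hD : D ∈ 𝓝 x)
    (hV : DifferentiableAt ℝ V x) : EqUpTo κ ‖∇ V x‖ₑ ‖g‖ₑ := by
  have hclose : ‖∇ V x - g‖₊ ≤ (1 - κ⁻¹) * ‖g‖₊ := by
    rw [← (InnerProductSpace.toDual ℝ E).nnnorm_map, map_sub, gradient,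
      LinearIsometryEquiv.apply_symm_apply]
    exact (hV.hasFDerivAt.sub (InnerProductSpace.toDual ℝ E g).hasFDerivAt).le_of_lipschitzOn hD
      (ApproximatesLinearOn.approximatesLinearOn_iff_lipschitzOnWith.1 h.approximatesLinearOn)
  simp only [EqUpTo, enorm_eq_nnnorm]
  norm_cast
  constructor
  · calc ‖∇ V x‖₊ ≤ ‖g‖₊ + ‖∇ V x - g‖₊ := by simpa using nnnorm_add_le g (∇ V x - g)
      _ ≤ (1 + (1 - κ⁻¹)) * ‖g‖₊ := by rw [add_mul, one_mul]; gcongr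
      _ ≤ κ * ‖g‖₊ := by gcongr; exact one_add_one_sub_inv_le h.one_le
  · have hκ : 0 < κ := zero_lt_one.trans_le h.one_le
    rw [← inv_mul_le_iff₀ hκ, ← add_le_add_iff_right ((1 - κ⁻¹) * ‖g‖₊), ← add_mul,
      add_tsub_cancel_of_le (inv_le_one_of_one_le₀ h.one_le), one_mul]
    calc ‖g‖₊ ≤ ‖∇ V x‖₊ + ‖∇ V x - g‖₊ := by simpa using nnnorm_sub_le (∇ V x) (∇ V x - g)
      _ ≤ _ := by gcongr

variable [MeasurableSpace E] [BorelSpace E]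

theorem measurableSet_inter_preimage (h : AlmostLinearOn κ V g D) (hD : MeasurableSet D)
    {B : Set ℝ} (hB : MeasurableSet B) : MeasurableSet (D ∩ V ⁻¹' B) :=
  measurableSet_inter_preimage_of_continuousOn h.approximatesLinearOn.continuousOn hD hB

theorem eqUpTo_setLIntegral_levelSet (h : AlmostLinearOn κ V g D) (hD : MeasurableSet D) (r : ℝ)
    {f : E → ℝ≥0∞} (hf : Measurable f) :
    EqUpTo (κ ^ (finrank ℝ E - 1))
      (∫⁻ x in D ∩ V ⁻¹' {r}, f (straighten V g x) ∂μHE[finrank ℝ E - 1])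
      (∫⁻ y in straighten V g '' D ∩ {y | ⟪g, y⟫ = r}, f y ∂μHE[finrank ℝ E - 1]) := by
  have himage := image_straighten_inter_preimage (V := V) h.ne_zero D {r}
  simp only [Set.mem_singleton_iff] at himage
  rw [← himage]
  exact (h.biLipschitzOn_straighten.mono Set.inter_subset_left).eqUpTo_setLIntegral_image
    (h.measurableSet_inter_preimage hD (measurableSet_singleton r)) _ hf

variable [FiniteDimensional ℝ E]

theorem eqUpTo_setLIntegral_preimage (h : AlmostLinearOn κ V g D) (hD : MeasurableSet D)
    {B : Set ℝ} (hB : MeasurableSet B) {f : E → ℝ≥0∞} (hf : Measurable f) :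
    EqUpTo (κ ^ finrank ℝ E) (∫⁻ x in D ∩ V ⁻¹' B, f (straighten V g x) ∂μHE[finrank ℝ E])
      (‖g‖ₑ⁻¹ * ∫⁻ r in B, ∫⁻ y in straighten V g '' D ∩ {y | ⟪g, y⟫ = r}, f y
        ∂μHE[finrank ℝ E - 1]) := by
  have hΦ := h.biLipschitzOn_straighten
  have himage : MeasurableSet (straighten V g '' D) :=
    hD.image_of_continuousOn_injOn hΦ.1.continuousOn hΦ.injOn
  rw [← setLIntegral_slab_eq_lintegral_hyperplane h.ne_zero himage hB hf,
    ← image_straighten_inter_preimage h.ne_zero]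
  exact (hΦ.mono Set.inter_subset_left).eqUpTo_setLIntegral_image
    (h.measurableSet_inter_preimage hD hB) _ hf

end AlmostLinearOn

theorem exists_isOpen_almostLinearOn {x : E} (hV : ContDiffAt ℝ 1 V x) (hg : ∇ V x ≠ 0)
    {A : Set E} (hA : A ∈ 𝓝 x) (hκ : 1 < κ) :
    ∃ U, IsOpen U ∧ x ∈ U ∧ U ⊆ A ∧ AlmostLinearOn κ V (∇ V x) U ∧
      ∀ y ∈ U, DifferentiableAt ℝ V y := by
  have hη : 0 < 1 - κ⁻¹ := tsub_pos_of_lt (inv_lt_one_of_one_lt₀ hκ)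
  have hgrad : HasStrictFDerivAt V (InnerProductSpace.toDual ℝ E (∇ V x)) x := by
    simpa [gradient] using hV.hasStrictFDerivAt one_ne_zero
  obtain ⟨S, hS, happ⟩ := hgrad.approximates_deriv_on_nhds
    (c := (1 - κ⁻¹) * ‖∇ V x‖₊) (Or.inr (mul_pos hη (by simpa using hg)))
  have hdiff : ∀ᶠ y in 𝓝 x, DifferentiableAt ℝ V y :=
    (hV.eventually (by simp)).mono fun y hy => hy.differentiableAt one_ne_zero
  obtain ⟨U, hUsub, hU, hxU⟩ := mem_nhds_iff.1 (inter_mem (inter_mem hS hA) hdiff)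
  exact ⟨U, hU, hxU, fun y hy => (hUsub hy).1.2,
    ⟨hκ.le, hg, happ.mono_set fun y hy => (hUsub hy).1.1⟩, fun y hy => (hUsub hy).2⟩

end AlmostLinear

section Coarea

theorem tsum_lintegral_le_lintegral_tsum {α : Type*} [MeasurableSpace α] {μ : Measure α}
    (f : ℕ → α → ℝ≥0∞) : ∑' n, ∫⁻ a, f n a ∂μ ≤ ∫⁻ a, ∑' n, f n a ∂μ := by
  choose g hg hgf hfg using fun n => exists_measurable_le_lintegral_eq μ (f n)
  simp_rw [hfg]
  rw [← lintegral_tsum fun n => (hg n).aemeasurable]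
  exact lintegral_mono fun a => ENNReal.tsum_le_tsum fun n => hgf n a

theorem tsum_lintegral_measure_le {α β : Type*} [MeasurableSpace α] [MeasurableSpace β]
    {μ : Measure α} {ν : Measure β} {t : ℕ → Set β} (ht : Pairwise (Function.onFun Disjoint t))
    (htm : ∀ k, MeasurableSet (t k)) (S : α → Set β) :
    ∑' k, ∫⁻ a, ν (S a ∩ t k) ∂μ ≤ ∫⁻ a, ν (S a) ∂μ := by
  refine (tsum_lintegral_le_lintegral_tsum _).trans (lintegral_mono fun a => ?_)
  calc ∑' k, ν (S a ∩ t k) = ∑' k, ν.restrict (t k) (S a) :=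
        tsum_congr fun k => (Measure.restrict_apply' (htm k)).symm
    _ = ν.restrict (⋃ k, t k) (S a) := by
        rw [Measure.restrict_iUnion ht htm, Measure.sum_apply_of_countable]
    _ ≤ ν (S a) := Measure.restrict_apply_le _ _

variable {E : Type*} [NormedAddCommGroup E] [InnerProductSpace ℝ E] [FiniteDimensional ℝ E]
  {V : E → ℝ} {A : Set E} [MeasurableSpace E] [BorelSpace E]

theorem AlmostLinearOn.enorm_mul_measure_le_lintegral_levelSet {κ : ℝ≥0} {g : E} {D : Set E}
    (h : AlmostLinearOn κ V g D) (hD : MeasurableSet D) :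
    ‖g‖ₑ * μHE[finrank ℝ E] D ≤ (κ : ℝ≥0∞) ^ (finrank ℝ E + (finrank ℝ E - 1)) *
      ∫⁻ r, μHE[finrank ℝ E - 1] (D ∩ V ⁻¹' {r}) := by
  have hvol := (h.eqUpTo_setLIntegral_preimage hD .univ measurable_one).1
  have hlevel := fun r => (h.eqUpTo_setLIntegral_levelSet hD r measurable_one).2
  simp only [Pi.one_apply, lintegral_one, Measure.restrict_apply_univ, Set.preimage_univ,
    Set.inter_univ, Measure.restrict_univ, ENNReal.coe_pow] at hvol hlevel
  calc ‖g‖ₑ * μHE[finrank ℝ E] D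
      ≤ ‖g‖ₑ * (κ ^ finrank ℝ E * (‖g‖ₑ⁻¹ * ∫⁻ r,
          κ ^ (finrank ℝ E - 1) * μHE[finrank ℝ E - 1] (D ∩ V ⁻¹' {r}))) := by
        gcongr
        refine hvol.trans ?_
        gcongr with r
        exact hlevel r
    _ = _ := by
        rw [lintegral_const_mul' _ _ (by finiteness), mul_left_comm, ← mul_assoc ‖g‖ₑ,
          ENNReal.mul_inv_cancel (by simpa using h.ne_zero) (by simp), one_mul, pow_add, mul_assoc]

theorem exists_partition_almostLinearOn {g : E → E} {κ : ℝ≥0} (hκ : 1 < κ) (hne : A.Nonempty)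
    (hV : ∀ x ∈ A, HasGradientWithinAt V (g x) A x) (hg : ∀ x ∈ A, g x ≠ 0) :
    ∃ (t : ℕ → Set E) (y : ℕ → E), Pairwise (Function.onFun Disjoint t) ∧
      (∀ k, MeasurableSet (t k)) ∧ A ⊆ ⋃ k, t k ∧
      ∀ k, y k ∈ A ∧ AlmostLinearOn κ V (g (y k)) (A ∩ t k) := by
  classical
  have hη : 0 < 1 - κ⁻¹ := tsub_pos_of_lt (inv_lt_one_of_one_lt₀ hκ)
  obtain ⟨t, L, htd, htm, hAt, happ, hL⟩ :=
    exists_partition_approximatesLinearOn_of_hasFDerivWithinAt V A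
      (fun x => InnerProductSpace.toDual ℝ E (g x)) (fun x hx => (hV x hx).hasFDerivWithinAt)
      (fun L => if L = 0 then 1 else (1 - κ⁻¹) * ‖L‖₊) (fun L => by
        split_ifs with h
        exacts [one_ne_zero, mul_ne_zero hη.ne' (by simpa using h)])
  choose y hyA hLy using hL hne
  refine ⟨t, y, htd, htm, hAt, fun k => ⟨hyA k, hκ.le, hg _ (hyA k), ?_⟩⟩
  have hk := happ k
  rwa [hLy k, if_neg (by simpa using hg _ (hyA k)), LinearIsometryEquiv.nnnorm_map] at hk

theorem measure_le_lintegral_levelSet {g : E → E} {G : ℝ} (hG : 0 < G) (hA : MeasurableSet A)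
    (hV : ∀ x ∈ A, HasGradientWithinAt V (g x) A x) (hg : ∀ x ∈ A, G ≤ ‖g x‖) :
    μHE[finrank ℝ E] A ≤
      ENNReal.ofReal G⁻¹ * ∫⁻ r, μHE[finrank ℝ E - 1] (A ∩ V ⁻¹' {r}) := by
  rcases A.eq_empty_or_nonempty with rfl | hne
  · simp
  set n := finrank ℝ E
  rw [ENNReal.ofReal_inv_of_pos hG, ← ENNReal.mul_le_iff_le_inv (by simpa using hG) (by simp)]
  refine le_of_forall_one_lt_le_pow_mul (n + (n - 1)) fun κ hκ => ?_
  obtain ⟨t, y, htd, htm, hAt, hty⟩ := exists_partition_almostLinearOn hκ hne hV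
    fun x hx => norm_pos_iff.1 (hG.trans_le (hg x hx))
  have hpiece : ∀ k, ENNReal.ofReal G * μHE[n] (A ∩ t k) ≤
      (κ : ℝ≥0∞) ^ (n + (n - 1)) * ∫⁻ r, μHE[n - 1] (A ∩ V ⁻¹' {r} ∩ t k) := fun k => by
    calc ENNReal.ofReal G * μHE[n] (A ∩ t k) ≤ ‖g (y k)‖ₑ * μHE[n] (A ∩ t k) := by
          gcongr
          simpa only [ofReal_norm] using ENNReal.ofReal_le_ofReal (hg _ (hty k).1)
      _ ≤ _ := by
          simpa only [Set.inter_right_comm] using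
            (hty k).2.enorm_mul_measure_le_lintegral_levelSet (hA.inter (htm k))
  have hsum : μHE[n] A = ∑' k, μHE[n] (A ∩ t k) := by
    rw [← measure_iUnion (fun i j hij => (htd hij).mono Set.inter_subset_right
      Set.inter_subset_right) fun k => hA.inter (htm k), ← Set.inter_iUnion,
      Set.inter_eq_left.2 hAt]
  calc ENNReal.ofReal G * μHE[n] A
      ≤ ∑' k, (κ : ℝ≥0∞) ^ (n + (n - 1)) * ∫⁻ r, μHE[n - 1] (A ∩ V ⁻¹' {r} ∩ t k) := by
        rw [hsum, ← ENNReal.tsum_mul_left]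
        exact ENNReal.tsum_le_tsum hpiece
    _ ≤ (κ : ℝ≥0∞) ^ (n + (n - 1)) * ∫⁻ r, μHE[n - 1] (A ∩ V ⁻¹' {r}) := by
        rw [ENNReal.tsum_mul_left]
        gcongr
        exact tsum_lintegral_measure_le htd htm _

theorem measure_le_lintegral_levelSet_of_ae {G : ℝ} (hG : 0 < G) (hA : MeasurableSet A)
    (hg : ∀ᵐ x ∂μHE[finrank ℝ E].restrict A, ∃ g, HasGradientWithinAt V g A x ∧ G ≤ ‖g‖) :
    μHE[finrank ℝ E] A ≤
      ENNReal.ofReal G⁻¹ * ∫⁻ r, μHE[finrank ℝ E - 1] (A ∩ V ⁻¹' {r}) := by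
  rw [ae_restrict_iff' hA] at hg
  obtain ⟨N, hN, hNm, hN0⟩ := exists_measurable_superset_of_null (ae_iff.1 hg)
  have hgood : ∀ x ∈ A \ N, ∃ g, HasGradientWithinAt V g A x ∧ G ≤ ‖g‖ := fun x hx => by
    by_contra hbad
    exact hx.2 (hN fun h => hbad (h hx.1))
  choose! g hVg hGg using hgood
  calc μHE[finrank ℝ E] A = μHE[finrank ℝ E] (A \ N) := (measure_sdiff_null hN0).symm
    _ ≤ ENNReal.ofReal G⁻¹ * ∫⁻ r, μHE[finrank ℝ E - 1] (A \ N ∩ V ⁻¹' {r}) :=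
        measure_le_lintegral_levelSet hG (hA.diff hNm) (fun x hx =>
          HasFDerivWithinAt.mono (hVg x hx).hasFDerivWithinAt Set.sdiff_subset) hGg
    _ ≤ _ := by
        gcongr
        exact Set.sdiff_subset

end Coarea

section DistributionFunction

theorem ae_restrict_rnDeriv_le (ν : Measure ℝ) {u : ℝ → ℝ≥0∞} {U : Set ℝ} (hU : MeasurableSet U)
    (h : ∀ B ⊆ U, MeasurableSet B → ν B ≤ ∫⁻ r in B, u r) :
    ∀ᵐ r ∂volume.restrict U, ν.rnDeriv volume r ≤ u r := by
  refine ae_le_of_forall_setLIntegral_le_of_sigmaFinite (measurable_rnDeriv _ _) fun B hB _ => ?_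
  rw [Measure.restrict_restrict hB]
  exact (setLIntegral_rnDeriv_le _).trans (h _ Set.inter_subset_right (hB.inter hU))

variable (ν : Measure ℝ) [IsFiniteMeasure ν]

theorem continuousWithinAt_measureReal_Iic (x : ℝ) :
    ContinuousWithinAt (fun t => ν.real (Set.Iic t)) (Set.Ici x) x := by
  rw [← continuousWithinAt_Ioi_iff_Ici]
  have hlim := tendsto_measure_biInter_gt (μ := ν) (s := fun t : ℝ => Set.Iic t) (a := x)
    (fun r _ => measurableSet_Iic.nullMeasurableSet) (fun i j _ hij => Set.Iic_subset_Iic.2 hij)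
    ⟨x + 1, by simp, measure_ne_top _ _⟩
  have hinter : ⋂ r > x, Set.Iic r = Set.Iic x := by
    ext y
    simp only [Set.mem_iInter, Set.mem_Iic]
    exact forall_gt_imp_ge_iff_le_of_dense
  rw [hinter] at hlim
  exact (ENNReal.tendsto_toReal (measure_ne_top _ _)).comp hlim

theorem ae_hasDerivAt_measureReal_Iic :
    ∀ᵐ x, HasDerivAt (fun t => ν.real (Set.Iic t)) (ν.rnDeriv volume x).toReal x := by
  let F : StieltjesFunction ℝ :=
    { toFun := fun t => ν.real (Set.Iic t)
      mono' := fun s t hst => measureReal_mono (Set.Iic_subset_Iic.2 hst)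
      right_continuous' := continuousWithinAt_measureReal_Iic ν }
  have hF : F.measure = ν := by
    refine Measure.ext_of_Ioc _ _ fun a b hab => ?_
    rw [F.measure_Ioc]
    change ENNReal.ofReal (ν.real (Set.Iic b) - ν.real (Set.Iic a)) = _
    rw [← measureReal_sdiff (Set.Iic_subset_Iic.2 hab.le) measurableSet_Iic, Set.Iic_sdiff_Iic,
      ofReal_measureReal]
  simpa only [hF] using F.ae_hasDerivAt

end DistributionFunction

section SubLevel

variable {d : ℕ} {X : Set (EuclideanSpace ℝ (Fin d))} {V : EuclideanSpace ℝ (Fin d) → ℝ}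

theorem subLevel_eq_inter_preimage (t : ℝ) : subLevel X V t = X ∩ V ⁻¹' Set.Iic t := rfl

theorem subLevel_mono {s t : ℝ} (h : s ≤ t) : subLevel X V s ⊆ subLevel X V t :=
  fun _ hx => ⟨hx.1, hx.2.trans h⟩

theorem subLevel_sdiff_subLevel (s t : ℝ) :
    subLevel X V t \ subLevel X V s = X ∩ V ⁻¹' Set.Ioc s t := by
  ext x
  simp only [subLevel, Set.mem_sdiff, Set.mem_ofPred_eq, Set.mem_inter_iff, Set.mem_preimage,
    Set.mem_Ioc]
  grind

theorem measurableSet_subLevel (hX : MeasurableSet X) (hV : ContinuousOn V X) (t : ℝ) :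
    MeasurableSet (subLevel X V t) :=
  measurableSet_inter_preimage_of_continuousOn hV hX measurableSet_Iic

theorem volume_inter_preimage_le_lintegral_surfaceArea (hX : MeasurableSet X)
    (hV : ContinuousOn V X) {G : ℝ} (hG : 0 < G) {B : Set ℝ} (hB : MeasurableSet B)
    (hg : ∀ᵐ x ∂volume.restrict (X ∩ V ⁻¹' B), ∃ g, HasGradientWithinAt V g X x ∧ G ≤ ‖g‖) :
    volume (X ∩ V ⁻¹' B) ≤ ENNReal.ofReal G⁻¹ * ∫⁻ r in B, surfaceArea X V r := by
  have hcoarea := measure_le_lintegral_levelSet_of_ae (V := V) hG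
    (measurableSet_inter_preimage_of_continuousOn hV hX hB)
  rw [finrank_euclideanSpace_fin, EuclideanSpace.euclideanHausdorffMeasure_eq_volume] at hcoarea
  refine (hcoarea ?_).trans ?_
  · filter_upwards [hg] with x ⟨g, hgx, hGg⟩
    exact ⟨g, HasFDerivWithinAt.mono hgx.hasFDerivWithinAt Set.inter_subset_left, hGg⟩
  · rw [← lintegral_indicator hB]
    gcongr with r
    by_cases hr : r ∈ B
    · rw [Set.indicator_of_mem hr]
      exact measure_mono fun x hx => ⟨hx.1.1, hx.2⟩
    · have hempty : X ∩ V ⁻¹' B ∩ V ⁻¹' {r} = ∅ :=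
        Set.eq_empty_of_forall_notMem fun x hx => hr (hx.2 ▸ hx.1.2)
      rw [hempty, measure_empty]
      exact zero_le

theorem eventually_volume_sdiff_le_of_hasDerivAt (hX : MeasurableSet X) (hV : ContinuousOn V X)
    {c c' ρ R : ℝ} (hcc' : c < c') (hfin : volume (subLevel X V c') ≠ ∞)
    (hder : HasDerivAt (fun t => volume.real (subLevel X V t)) ρ c) (hR : ρ < R) :
    ∀ᶠ t in 𝓝[>] c,
      volume (subLevel X V t \ subLevel X V c) ≤ ENNReal.ofReal (R * (t - c)) := by
  have hslope : ∀ᶠ t in 𝓝[>] c, slope (fun t => volume.real (subLevel X V t)) c t < R :=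
    ((hasDerivWithinAt_iff_tendsto_slope' Set.self_notMem_Ioi).1
      hder.hasDerivWithinAt).eventually_lt_const hR
  filter_upwards [hslope, Ioo_mem_nhdsGT hcc'] with t ht htc
  have hfint := measure_ne_top_of_subset (subLevel_mono htc.2.le) hfin
  rw [slope_def_field, div_lt_iff₀ (sub_pos.2 htc.1), ← measureReal_sdiff
    (subLevel_mono htc.1.le) (measurableSet_subLevel hX hV c) hfint] at ht
  rw [← ofReal_measureReal (measure_ne_top_of_subset Set.sdiff_subset hfint)]
  exact ENNReal.ofReal_le_ofReal ht.le

theorem growthBoundAt_of_hasDerivAt (hX : MeasurableSet X) (hV : ContinuousOn V X)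
    {G c c' ρ : ℝ} (hG : 0 < G) (hc : 0 < c) (hcc' : c < c')
    (hfin : volume (subLevel X V c') ≠ ∞)
    (hder : HasDerivAt (fun t => volume.real (subLevel X V t)) ρ c)
    (hρ : ENNReal.ofReal ρ ≤ ENNReal.ofReal G⁻¹ * surfaceArea X V c) : GrowthBoundAt X V G c := by
  refine ⟨⟨ρ, hder, hρ⟩, fun ε hε => ?_⟩
  have hG' : 0 < G⁻¹ := inv_pos.2 hG
  have hgap := eventually_volume_sdiff_le_of_hasDerivAt hX hV hcc' hfin hder
    (lt_add_of_pos_right ρ (mul_pos hG' hε))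
  have hscale : Tendsto (fun α : ℝ => α * c) (𝓝[>] 1) (𝓝[>] c) := by
    refine tendsto_nhdsWithin_iff.2 ⟨?_, ?_⟩
    · have hcont : ContinuousWithinAt (fun α : ℝ => α * c) (Set.Ioi 1) 1 := by fun_prop
      simpa [ContinuousWithinAt] using hcont
    · filter_upwards [self_mem_nhdsWithin] with α hα
      exact (lt_mul_iff_one_lt_left hc).2 hα
  filter_upwards [hscale.eventually hgap, self_mem_nhdsWithin] with α hα (hα1 : 1 < α)
  have hpos : 0 ≤ c * (α - 1) := mul_nonneg hc.le (sub_nonneg.2 hα1.le)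
  calc volume (subLevel X V (α * c) \ subLevel X V c)
      ≤ ENNReal.ofReal (c * (α - 1)) * ENNReal.ofReal (ρ + G⁻¹ * ε) := by
        rw [← ENNReal.ofReal_mul hpos]
        convert hα using 2
        ring
    _ ≤ ENNReal.ofReal (c * (α - 1)) *
          (ENNReal.ofReal G⁻¹ * surfaceArea X V c + ENNReal.ofReal G⁻¹ * ENNReal.ofReal ε) := by
        rw [← ENNReal.ofReal_mul hG'.le]
        gcongr
        exact ENNReal.ofReal_add_le.trans (by gcongr)
    _ = ENNReal.ofReal (c * (α - 1) * G⁻¹) * (surfaceArea X V c + ENNReal.ofReal ε) := by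
        rw [ENNReal.ofReal_mul hpos, ← mul_add, mul_assoc]

theorem ae_growthBoundAt (hX : MeasurableSet X) (hV : ContinuousOn V X)
    {G a b : ℝ} (hG : 0 < G) (ha : 0 ≤ a)
    (hg : ∀ᵐ x ∂volume.restrict (X ∩ V ⁻¹' Set.Ioc a b),
      ∃ g, HasGradientWithinAt V g X x ∧ G ≤ ‖g‖)
    (hfin : volume (subLevel X V b) ≠ ∞) :
    ∀ᵐ c ∂volume.restrict (Set.Ioo a b), GrowthBoundAt X V G c := by
  have hS : MeasurableSet (subLevel X V b) := measurableSet_subLevel hX hV b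
  have hVS : ContinuousOn V (subLevel X V b) := hV.mono fun x hx => hx.1
  have : IsFiniteMeasure (volume.restrict (subLevel X V b)) := ⟨by simpa using hfin.lt_top⟩
  set ν : Measure ℝ := (volume.restrict (subLevel X V b)).map V
  have hν : ∀ B ⊆ Set.Iic b, MeasurableSet B → ν B = volume (X ∩ V ⁻¹' B) := fun B hBb hB => by
    rw [Measure.map_apply_of_aemeasurable (hVS.aemeasurable hS) hB, Measure.restrict_apply' hS,
      subLevel_eq_inter_preimage, Set.inter_left_comm, ← Set.preimage_inter,
      Set.inter_eq_left.2 hBb]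
  have hdens : ∀ᵐ c ∂volume.restrict (Set.Ioo a b),
      ν.rnDeriv volume c ≤ ENNReal.ofReal G⁻¹ * surfaceArea X V c := by
    refine ae_restrict_rnDeriv_le ν measurableSet_Ioo fun B hBU hB => ?_
    rw [hν B (fun r hr => (hBU hr).2.le) hB, lintegral_const_mul' _ _ ENNReal.ofReal_ne_top]
    refine volume_inter_preimage_le_lintegral_surfaceArea hX hV hG hB
      (ae_restrict_of_ae_restrict_of_subset ?_ hg)
    gcongr
    exact hBU.trans Set.Ioo_subset_Ioc_self
  filter_upwards [hdens, ae_restrict_of_ae (ae_hasDerivAt_measureReal_Iic ν),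
    ae_restrict_mem measurableSet_Ioo] with c hc hder hcab
  refine growthBoundAt_of_hasDerivAt hX hV hG (ha.trans_lt hcab.1) hcab.2 hfin
    (hder.congr_of_eventuallyEq ?_) (ENNReal.ofReal_toReal_le.trans hc)
  filter_upwards [Iio_mem_nhds hcab.2] with t ht
  rw [measureReal_def, measureReal_def, hν _ (Set.Iic_subset_Iic.2 (le_of_lt ht)) measurableSet_Iic,
    subLevel_eq_inter_preimage]

end SubLevel

section LocalGrowth

theorem setLIntegral_inter_of_support_subset {α : Type*} [MeasurableSpace α] {μ : Measure α}
    {f : α → ℝ≥0∞} {U : Set α} (hU : MeasurableSet U) (hf : Function.support f ⊆ U) (S : Set α) :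
    ∫⁻ x in U ∩ S, f x ∂μ = ∫⁻ x in S, f x ∂μ := by
  rw [← setLIntegral_indicator hU, Set.indicator_eq_self.2 hf]

theorem tendsto_setLIntegral_uIoc_div {m : ℝ → ℝ≥0} (hm : Continuous m) (c : ℝ) :
    Tendsto (fun t => (∫⁻ r in Set.uIoc c t, m r) / ENNReal.ofReal |t - c|) (𝓝[≠] c)
      (𝓝 (m c)) := by
  have hm' : Continuous fun r => (m r : ℝ) := NNReal.continuous_coe.comp hm
  have hslope := (hm'.integral_hasStrictDerivAt c c).hasDerivAt.tendsto_slope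
  have habs := ENNReal.tendsto_ofReal hslope.abs
  rw [NNReal.abs_eq, ENNReal.ofReal_coe_nnreal] at habs
  refine habs.congr' ?_
  filter_upwards [self_mem_nhdsWithin] with t (ht : t ≠ c)
  have hint : IntegrableOn (fun r => (m r : ℝ)) (Set.uIoc c t) :=
    intervalIntegrable_iff.1 (hm'.intervalIntegrable c t)
  rw [slope_def_field, intervalIntegral.integral_same, sub_zero, abs_div,
    intervalIntegral.abs_intervalIntegral_eq,
    ENNReal.ofReal_div_of_pos (abs_pos.2 (sub_ne_zero.2 ht)),
    abs_of_nonneg (integral_nonneg fun r => (m r).2), lintegral_coe_eq_integral _ hint]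

theorem continuous_indicator_comp_symm {X Y : Type*} [TopologicalSpace X]
    [TopologicalSpace Y] [T2Space Y] (e : OpenPartialHomeomorph X Y) {φ : X → ℝ≥0}
    (hφ : Continuous φ) (hφs : HasCompactSupport φ) (hφe : tsupport φ ⊆ e.source) :
    Continuous (e.target.indicator (φ ∘ e.symm)) ∧
      HasCompactSupport (e.target.indicator (φ ∘ e.symm)) := by
  have hK : IsCompact (e '' tsupport φ) :=
    hφs.isCompact.image_of_continuousOn (e.continuousOn.mono hφe)
  have hsupp : tsupport (e.target.indicator (φ ∘ e.symm)) ⊆ e '' tsupport φ := by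
    refine closure_minimal (fun y hy => ?_) hK.isClosed
    rw [Function.mem_support, Set.indicator_apply_ne_zero] at hy
    exact ⟨e.symm y, subset_tsupport _ hy.2, e.right_inv hy.1⟩
  refine ⟨ContinuousOn.continuous_of_tsupport_subset ?_ e.open_target (hsupp.trans ?_),
    hK.of_isClosed_subset (isClosed_tsupport _) hsupp⟩
  · exact (hφ.comp_continuousOn e.continuousOn_symm).congr fun y hy => Set.indicator_of_mem hy _
  · exact Set.image_subset_iff.2 fun x hx => e.map_source (hφe hx)

variable {E : Type*} [NormedAddCommGroup E] [InnerProductSpace ℝ E] {V : E → ℝ} {g : E} {U : Set E}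
  {κ : ℝ≥0} {φ : E → ℝ≥0}

namespace AlmostLinearOn

theorem exists_continuous_comp_straighten [CompleteSpace E] (h : AlmostLinearOn κ V g U)
    (hU : IsOpen U) (hφ : Continuous φ) (hφs : HasCompactSupport φ) (hφU : tsupport φ ⊆ U) :
    ∃ ψ : E → ℝ≥0, Continuous ψ ∧ HasCompactSupport ψ ∧
      Function.support ψ ⊆ straighten V g '' U ∧ ∀ x ∈ U, ψ (straighten V g x) = φ x := by
  let e : OpenPartialHomeomorph E E :=
    h.approximatesLinearOn_straighten.toOpenPartialHomeomorph (straighten V g) U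
      (Or.inr h.one_sub_inv_lt_inv_nnnorm_refl) hU
  obtain ⟨hcont, hcomp⟩ := continuous_indicator_comp_symm e hφ hφs hφU
  refine ⟨_, hcont, hcomp, Set.support_indicator_subset, fun x (hx : x ∈ e.source) => ?_⟩
  change e.target.indicator (φ ∘ e.symm) (e x) = φ x
  rw [Set.indicator_of_mem (e.map_source hx), Function.comp_apply, e.left_inv hx]

variable [FiniteDimensional ℝ E] [MeasurableSpace E] [BorelSpace E]

theorem exists_continuous_eqUpTo_setLIntegral (h : AlmostLinearOn κ V g U) (hU : IsOpen U)
    (hφ : Continuous φ) (hφs : HasCompactSupport φ) (hφU : tsupport φ ⊆ U) :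
    ∃ m : ℝ → ℝ≥0, Continuous m ∧
      (∀ B, MeasurableSet B → EqUpTo (κ ^ finrank ℝ E)
        (∫⁻ x in U ∩ V ⁻¹' B, φ x ∂μHE[finrank ℝ E]) (‖g‖ₑ⁻¹ * ∫⁻ r in B, m r)) ∧
      ∀ r, EqUpTo (κ ^ (finrank ℝ E - 1))
        (∫⁻ x in U ∩ V ⁻¹' {r}, φ x ∂μHE[finrank ℝ E - 1]) (m r) := by
  have hΦ := h.biLipschitzOn_straighten
  have himage : MeasurableSet (straighten V g '' U) :=
    hU.measurableSet.image_of_continuousOn_injOn hΦ.1.continuousOn hΦ.injOn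
  obtain ⟨ψ, hψ, hψs, hψU, hψφ⟩ := h.exists_continuous_comp_straighten hU hφ hφs hφU
  obtain ⟨m, hm, hψm⟩ := exists_continuous_setLIntegral_hyperplane h.ne_zero hψ hψs
  have hslice : ∀ r, ∫⁻ y in straighten V g '' U ∩ {y | ⟪g, y⟫ = r}, ψ y ∂μHE[finrank ℝ E - 1] =
      m r := fun r => by
    rw [setLIntegral_inter_of_support_subset himage (by simpa [Function.support] using hψU), hψm]
  have hcomp : ∀ (k : ℕ) (B : Set ℝ), MeasurableSet B →
      ∫⁻ x in U ∩ V ⁻¹' B, φ x ∂μHE[k] =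
        ∫⁻ x in U ∩ V ⁻¹' B, ψ (straighten V g x) ∂μHE[k] := fun k B hB =>
    setLIntegral_congr_fun (h.measurableSet_inter_preimage hU.measurableSet hB)
      fun x hx => by simp only [hψφ x hx.1]
  have hψmeas : Measurable fun y => (ψ y : ℝ≥0∞) := by fun_prop
  refine ⟨m, hm, fun B hB => ?_, fun r => ?_⟩
  · simpa only [hcomp _ B hB, hslice] using
      h.eqUpTo_setLIntegral_preimage hU.measurableSet hB hψmeas
  · simpa only [hcomp _ _ (measurableSet_singleton r), hslice] using
      h.eqUpTo_setLIntegral_levelSet hU.measurableSet r hψmeas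

theorem tendstoUpTo_setLIntegral_uIoc_div (h : AlmostLinearOn κ V g U) (hU : IsOpen U)
    (hV : ∀ x ∈ U, DifferentiableAt ℝ V x) (hφ : Continuous φ) (hφs : HasCompactSupport φ)
    (hφU : tsupport φ ⊆ U) (c : ℝ) :
    TendstoUpTo (κ ^ finrank ℝ E)
      (fun t => (∫⁻ x in U ∩ V ⁻¹' Set.uIoc c t, φ x ∂μHE[finrank ℝ E]) / ENNReal.ofReal |t - c|)
      (𝓝[≠] c) (∫⁻ x in U ∩ V ⁻¹' {c}, φ x * ‖∇ V x‖ₑ⁻¹ ∂μHE[finrank ℝ E - 1]) := by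
  have : Nontrivial E := ⟨⟨g, 0, h.ne_zero⟩⟩
  have hκ : κ ≠ 0 := (zero_lt_one.trans_le h.one_le).ne'
  have hg : ‖g‖ₑ⁻¹ ≠ ∞ := by simpa using h.ne_zero
  obtain ⟨m, hm, hvol, hlevel⟩ := h.exists_continuous_eqUpTo_setLIntegral hU hφ hφs hφU
  refine ⟨fun t => ‖g‖ₑ⁻¹ * ((∫⁻ r in Set.uIoc c t, m r) / ENNReal.ofReal |t - c|),
    ‖g‖₊⁻¹ * m c, ?_, .of_forall fun t => ?_, ?_⟩
  · rw [ENNReal.coe_mul, ENNReal.coe_inv (by simpa using h.ne_zero)]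
    exact ENNReal.Tendsto.const_mul (tendsto_setLIntegral_uIoc_div hm c) (Or.inr hg)
  · simpa only [mul_div_assoc] using (hvol _ measurableSet_uIoc).div_right _
  · have hgrad : EqUpTo κ (∫⁻ x in U ∩ V ⁻¹' {c}, φ x * ‖∇ V x‖ₑ⁻¹ ∂μHE[finrank ℝ E - 1])
        (∫⁻ x in U ∩ V ⁻¹' {c}, φ x * ‖g‖ₑ⁻¹ ∂μHE[finrank ℝ E - 1]) :=
      EqUpTo.setLIntegral
        (h.measurableSet_inter_preimage hU.measurableSet (measurableSet_singleton c))
        fun x hx => ((h.eqUpTo_enorm_gradient (hU.mem_nhds hx.1) (hV x hx.1)).inv hκ).mul_left _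
    rw [lintegral_mul_const' _ _ hg, mul_comm _ ‖g‖ₑ⁻¹] at hgrad
    rw [← mul_pow_sub_one finrank_pos.ne', ENNReal.coe_mul,
      ENNReal.coe_inv (by simpa using h.ne_zero)]
    exact hgrad.trans ((hlevel c).mul_left _)

end AlmostLinearOn

end LocalGrowth

section CompactLevelSets

theorem exists_continuous_sum_eq_one_of_isCompact {X : Type*} [TopologicalSpace X] [T2Space X]
    [LocallyCompactSpace X] {K : Set X} (hK : IsCompact K) {U : X → Set X}
    (hU : ∀ x ∈ K, IsOpen (U x)) (hxU : ∀ x ∈ K, x ∈ U x) :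
    ∃ (N : ℕ) (y : Fin N → X) (φ : Fin N → X → ℝ≥0),
      (∀ i, y i ∈ K ∧ Continuous (φ i) ∧ HasCompactSupport (φ i) ∧ tsupport (φ i) ⊆ U (y i)) ∧
      ∀ᶠ x in 𝓝ˢ K, ∑ i, φ i x = 1 := by
  obtain ⟨s, hsK, hs⟩ := hK.elim_nhds_subcover U fun x hx => (hU x hx).mem_nhds (hxU x hx)
  obtain ⟨L, hL, hKL, hLU⟩ := exists_compact_between hK
    (isOpen_biUnion fun x hx => hU x (hsK x hx)) hs
  let y : Fin s.card → X := fun i => s.equivFin.symm i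
  have hyK : ∀ i, y i ∈ K := fun i => hsK _ (s.equivFin.symm i).2
  have hLy : L ⊆ ⋃ i, U (y i) := hLU.trans <| Set.iUnion₂_subset fun x hx =>
    Set.subset_iUnion_of_subset (s.equivFin ⟨x, hx⟩) (by simp [y])
  obtain ⟨φ, hφU, hφ1, hφI, hφs⟩ :=
    exists_continuous_sum_one_of_isOpen_isCompact (fun i => hU _ (hyK i)) hL hLy
  refine ⟨s.card, y, fun i x => (φ i x).toNNReal, fun i => ⟨hyK i, ?_, ?_, ?_⟩, ?_⟩
  · fun_prop
  · exact (hφs i).comp_left Real.toNNReal_zero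
  · exact (closure_mono (Function.support_comp_subset Real.toNNReal_zero _)).trans (hφU i)
  · filter_upwards [isOpen_interior.mem_nhdsSet.2 hKL] with x hx
    rw [← Real.toNNReal_sum_of_nonneg fun i _ => (hφI i x).1]
    simpa using congrArg Real.toNNReal (hφ1 (interior_subset hx))

theorem eventually_inter_preimage_uIoc_subset {X : Type*} [TopologicalSpace X] {A W : Set X}
    {V : X → ℝ} {c : ℝ} (hA : IsCompact A) (hV : ContinuousOn V A) (hW : W ∈ 𝓝ˢ (A ∩ V ⁻¹' {c})) :
    ∀ᶠ t in 𝓝 c, A ∩ V ⁻¹' Set.uIoc c t ⊆ W := by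
  have hclosed : IsClosed (V '' (A \ interior W)) :=
    ((hA.diff isOpen_interior).image_of_continuousOn (hV.mono Set.sdiff_subset)).isClosed
  have hc : c ∉ V '' (A \ interior W) := by
    rintro ⟨x, ⟨hxA, hxW⟩, hxc⟩
    exact hxW (subset_interior_iff_mem_nhdsSet.2 hW ⟨hxA, hxc⟩)
  have huIcc : Tendsto (fun t => Set.uIcc c t) (𝓝 c) (𝓝 c).smallSets :=
    tendsto_const_nhds.uIcc tendsto_id
  filter_upwards [huIcc.eventually (eventually_smallSets_subset.2
    (hclosed.isOpen_compl.mem_nhds hc))] with t ht x hx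
  by_contra hxW
  exact ht (Set.uIoc_subset_uIcc hx.2) ⟨x, ⟨hx.1, fun h => hxW (interior_subset h)⟩, rfl⟩

theorem sum_setLIntegral_inter_mul_of_sum_eq_one {α ι : Type*} [MeasurableSpace α] {μ : Measure α}
    [Fintype ι] {φ : ι → α → ℝ≥0} (hφ : ∀ i, Measurable (φ i)) {U : ι → Set α}
    (hU : ∀ i, MeasurableSet (U i)) (hφU : ∀ i, Function.support (φ i) ⊆ U i) {S : Set α}
    (hS : MeasurableSet S) (hsum : ∀ x ∈ S, ∑ i, φ i x = 1) {w : α → ℝ≥0∞} (hw : Measurable w) :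
    ∑ i, ∫⁻ x in U i ∩ S, φ i x * w x ∂μ = ∫⁻ x in S, w x ∂μ := by
  have hsupp : ∀ i, Function.support (fun x => φ i x * w x) ⊆ U i := fun i x hx =>
    hφU i (by simpa using left_ne_zero_of_mul hx)
  simp only [setLIntegral_inter_of_support_subset (hU _) (hsupp _)]
  rw [← lintegral_finsetSum _ fun i _ => by fun_prop]
  refine setLIntegral_congr_fun hS fun x hx => ?_
  rw [← Finset.sum_mul, ← ENNReal.ofNNReal_finsetSum, hsum x hx, ENNReal.coe_one, one_mul]

variable {E : Type*} [NormedAddCommGroup E] [InnerProductSpace ℝ E] [FiniteDimensional ℝ E]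
  [MeasurableSpace E] [BorelSpace E] {V : E → ℝ}

theorem measurable_gradient (V : E → ℝ) : Measurable (∇ V) :=
  (InnerProductSpace.toDual ℝ E).symm.continuous.measurable.comp (measurable_fderiv ℝ V)

variable {A : Set E} {c : ℝ}

theorem tendstoUpTo_measure_inter_preimage_uIoc_div (hA : IsCompact A) (hV : ContinuousOn V A)
    (hreg : ∀ x ∈ A ∩ V ⁻¹' {c}, A ∈ 𝓝 x ∧ ContDiffAt ℝ 1 V x ∧ ∇ V x ≠ 0) {κ : ℝ≥0}
    (hκ : 1 < κ) :
    TendstoUpTo (κ ^ finrank ℝ E)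
      (fun t => μHE[finrank ℝ E] (A ∩ V ⁻¹' Set.uIoc c t) / ENNReal.ofReal |t - c|) (𝓝[≠] c)
      (∫⁻ x in A ∩ V ⁻¹' {c}, ‖∇ V x‖ₑ⁻¹ ∂μHE[finrank ℝ E - 1]) := by
  have hmeas : ∀ {B : Set ℝ}, MeasurableSet B → MeasurableSet (A ∩ V ⁻¹' B) :=
    measurableSet_inter_preimage_of_continuousOn hV hA.measurableSet
  have hlevel : IsCompact (A ∩ V ⁻¹' {c}) := hA.of_isClosed_subset
    (hV.preimage_isClosed_of_isClosed hA.isClosed isClosed_singleton) Set.inter_subset_left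
  choose! U hUo hxU hUA hU hUV using fun x hx =>
    exists_isOpen_almostLinearOn (hreg x hx).2.1 (hreg x hx).2.2 (hreg x hx).1 hκ
  obtain ⟨N, y, φ, hφ, hsum⟩ := exists_continuous_sum_eq_one_of_isCompact hlevel hUo hxU
  have hsplit : ∀ (k : ℕ) {B : Set ℝ} {w : E → ℝ≥0∞}, MeasurableSet B → Measurable w →
      (∀ x ∈ A ∩ V ⁻¹' B, ∑ i, φ i x = 1) →
      ∑ i, ∫⁻ x in U (y i) ∩ V ⁻¹' B, φ i x * w x ∂μHE[k] =
        ∫⁻ x in A ∩ V ⁻¹' B, w x ∂μHE[k] := fun k B w hB hw hAB => by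
    rw [← sum_setLIntegral_inter_mul_of_sum_eq_one (fun i => (hφ i).2.1.measurable)
      (fun i => (hUo _ (hφ i).1).measurableSet)
      (fun i => (subset_tsupport _).trans (hφ i).2.2.2) (hmeas hB) hAB hw]
    simp only [← Set.inter_assoc, Set.inter_eq_left.2 (hUA _ (hφ _).1)]
  have hpieces := TendstoUpTo.sum (s := Finset.univ) fun i _ =>
    (hU _ (hφ i).1).tendstoUpTo_setLIntegral_uIoc_div (hUo _ (hφ i).1) (hUV _ (hφ i).1)
      (hφ i).2.1 (hφ i).2.2.1 (hφ i).2.2.2 c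
  have hgrad : Measurable fun x => ‖∇ V x‖ₑ⁻¹ := (measurable_gradient V).enorm.inv
  rw [hsplit _ (measurableSet_singleton c) hgrad fun x hx =>
    subset_of_mem_nhdsSet hsum hx] at hpieces
  refine hpieces.congr ?_
  filter_upwards [nhdsWithin_le_nhds (eventually_inter_preimage_uIoc_subset hA hV hsum)] with t ht
  have hvol := hsplit (finrank ℝ E) measurableSet_uIoc measurable_one ht
  simp only [Pi.one_apply, mul_one, setLIntegral_one] at hvol
  simp only [ENNReal.div_eq_inv_mul, ← Finset.mul_sum, hvol]

theorem lintegral_inv_enorm_gradient_ne_top (hA : IsCompact A) (hV : ContinuousOn V A)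
    (hreg : ∀ x ∈ A ∩ V ⁻¹' {c}, A ∈ 𝓝 x ∧ ContDiffAt ℝ 1 V x ∧ ∇ V x ≠ 0) :
    ∫⁻ x in A ∩ V ⁻¹' {c}, ‖∇ V x‖ₑ⁻¹ ∂μHE[finrank ℝ E - 1] ≠ ∞ :=
  (tendstoUpTo_measure_inter_preimage_uIoc_div hA hV hreg one_lt_two).ne_top

theorem tendsto_measure_inter_preimage_uIoc_div (hA : IsCompact A)
    (hV : ContinuousOn V A)
    (hreg : ∀ x ∈ A ∩ V ⁻¹' {c}, A ∈ 𝓝 x ∧ ContDiffAt ℝ 1 V x ∧ ∇ V x ≠ 0) :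
    Tendsto (fun t => μHE[finrank ℝ E] (A ∩ V ⁻¹' Set.uIoc c t) / ENNReal.ofReal |t - c|) (𝓝[≠] c)
      (𝓝 (∫⁻ x in A ∩ V ⁻¹' {c}, ‖∇ V x‖ₑ⁻¹ ∂μHE[finrank ℝ E - 1])) :=
  tendsto_of_forall_tendstoUpTo_pow _ fun _ hκ =>
    tendstoUpTo_measure_inter_preimage_uIoc_div hA hV hreg hκ

end CompactLevelSets

section RegularLevel

variable {d : ℕ} {X : Set (EuclideanSpace ℝ (Fin d))} {V : EuclideanSpace ℝ (Fin d) → ℝ}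
  {G c c' : ℝ}

theorem subLevel_inter_preimage {B : Set ℝ} (hB : B ⊆ Set.Iic c') :
    subLevel X V c' ∩ V ⁻¹' B = X ∩ V ⁻¹' B := by
  rw [subLevel_eq_inter_preimage, Set.inter_assoc, ← Set.preimage_inter, Set.inter_eq_right.2 hB]

theorem levelSurface_eq_subLevel_inter (hcc' : c ≤ c') :
    levelSurface X V c = subLevel X V c' ∩ V ⁻¹' {c} :=
  (subLevel_inter_preimage (Set.singleton_subset_iff.2 hcc')).symm

theorem isCompact_levelSurface (hV : ContinuousOn V X) (hcc' : c ≤ c')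
    (hc' : IsCompact (subLevel X V c')) : IsCompact (levelSurface X V c) := by
  rw [levelSurface_eq_subLevel_inter hcc']
  exact hc'.of_isClosed_subset ((hV.mono fun x hx => hx.1).preimage_isClosed_of_isClosed
    hc'.isClosed isClosed_singleton) Set.inter_subset_left

theorem slope_measureReal_subLevel (hX : MeasurableSet X) (hV : ContinuousOn V X) {t : ℝ}
    (hcc' : c ≤ c') (htc' : t ≤ c') (htc : t ≠ c) (hfin : volume (subLevel X V c') ≠ ∞) :
    slope (fun t => volume.real (subLevel X V t)) c t =
      volume.real (X ∩ V ⁻¹' Set.uIoc c t) / |t - c| := by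
  have hsub : ∀ {r s : ℝ}, r ≤ s → s ≤ c' →
      volume.real (X ∩ V ⁻¹' Set.Ioc r s) =
        volume.real (subLevel X V s) - volume.real (subLevel X V r) := fun {r s} hrs hs => by
    rw [← subLevel_sdiff_subLevel, measureReal_sdiff (subLevel_mono hrs)
      (measurableSet_subLevel hX hV r) (measure_ne_top_of_subset (subLevel_mono hs) hfin)]
  rw [slope_def_field]
  rcases lt_or_gt_of_ne htc with h | h
  · rw [abs_of_neg (sub_neg.2 h), Set.uIoc_of_ge h.le, hsub h.le hcc', ← neg_div_neg_eq, neg_sub]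
  · rw [abs_of_pos (sub_pos.2 h), Set.uIoc_of_le h.le, hsub h.le htc']

theorem tendsto_volume_inter_preimage_uIoc_div (hV : ContinuousOn V X) (hcc' : c < c')
    (hc' : IsCompact (subLevel X V c'))
    (hreg : ∀ x ∈ levelSurface X V c, X ∈ 𝓝 x ∧ ContDiffAt ℝ 1 V x ∧ ∇ V x ≠ 0) :
    ∫⁻ x in levelSurface X V c, ‖∇ V x‖ₑ⁻¹ ∂μHE[d - 1] ≠ ∞ ∧
    Tendsto (fun t => volume (X ∩ V ⁻¹' Set.uIoc c t) / ENNReal.ofReal |t - c|) (𝓝[≠] c)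
      (𝓝 (∫⁻ x in levelSurface X V c, ‖∇ V x‖ₑ⁻¹ ∂μHE[d - 1])) := by
  have hreg' : ∀ x ∈ subLevel X V c' ∩ V ⁻¹' {c},
      subLevel X V c' ∈ 𝓝 x ∧ ContDiffAt ℝ 1 V x ∧ ∇ V x ≠ 0 := by
    rw [← levelSurface_eq_subLevel_inter hcc'.le]
    refine fun x hx => ⟨inter_mem (hreg x hx).1 ?_, (hreg x hx).2⟩
    exact (hreg x hx).2.1.continuousAt.preimage_mem_nhds (Iic_mem_nhds (hx.2.trans_lt hcc'))
  have hV' : ContinuousOn V (subLevel X V c') := hV.mono fun x hx => hx.1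
  have hfin := lintegral_inv_enorm_gradient_ne_top hc' hV' hreg'
  have hlim := tendsto_measure_inter_preimage_uIoc_div hc' hV' hreg'
  rw [← levelSurface_eq_subLevel_inter hcc'.le, finrank_euclideanSpace_fin] at hfin hlim
  rw [EuclideanSpace.euclideanHausdorffMeasure_eq_volume] at hlim
  refine ⟨hfin, hlim.congr' ?_⟩
  filter_upwards [nhdsWithin_le_nhds (Iio_mem_nhds hcc')] with t ht
  rw [subLevel_inter_preimage fun r hr => hr.2.trans (max_le hcc'.le (le_of_lt ht))]

theorem hasDerivAt_measureReal_subLevel (hX : MeasurableSet X) (hV : ContinuousOn V X)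
    (hcc' : c < c') (hc' : IsCompact (subLevel X V c'))
    (hreg : ∀ x ∈ levelSurface X V c, X ∈ 𝓝 x ∧ ContDiffAt ℝ 1 V x ∧ ∇ V x ≠ 0) :
    HasDerivAt (fun t => volume.real (subLevel X V t))
      (∫⁻ x in levelSurface X V c, ‖∇ V x‖ₑ⁻¹ ∂μHE[d - 1]).toReal c := by
  obtain ⟨hfin, hlim⟩ := tendsto_volume_inter_preimage_uIoc_div hV hcc' hc' hreg
  refine hasDerivAt_iff_tendsto_slope.2 (((ENNReal.tendsto_toReal hfin).comp hlim).congr' ?_)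
  filter_upwards [self_mem_nhdsWithin, nhdsWithin_le_nhds (Iio_mem_nhds hcc')] with t htc htc'
  rw [slope_measureReal_subLevel hX hV hcc'.le (le_of_lt htc') htc hc'.measure_ne_top,
    Function.comp_apply, ENNReal.toReal_div, ENNReal.toReal_ofReal (abs_nonneg _),
    measureReal_def]

theorem lintegral_inv_enorm_gradient_le (hm : MeasurableSet (levelSurface X V c)) (hG : 0 < G)
    (hg : ∀ x ∈ levelSurface X V c, G ≤ ‖∇ V x‖) :
    ∫⁻ x in levelSurface X V c, ‖∇ V x‖ₑ⁻¹ ∂μHE[d - 1] ≤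
      ENNReal.ofReal G⁻¹ * surfaceArea X V c := by
  rw [surfaceArea, ← setLIntegral_const]
  refine setLIntegral_mono' hm fun x hx => ?_
  rw [ENNReal.ofReal_inv_of_pos hG, ENNReal.inv_le_inv, ← ofReal_norm]
  exact ENNReal.ofReal_le_ofReal (hg x hx)

theorem lintegral_inv_enorm_gradient_eq (hm : MeasurableSet (levelSurface X V c)) (hG : 0 < G)
    (hg : ∀ x ∈ levelSurface X V c, ‖∇ V x‖ = G) :
    ∫⁻ x in levelSurface X V c, ‖∇ V x‖ₑ⁻¹ ∂μHE[d - 1] =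
      ENNReal.ofReal G⁻¹ * surfaceArea X V c := by
  rw [surfaceArea, ← setLIntegral_const]
  refine setLIntegral_congr_fun hm fun x hx => ?_
  rw [ENNReal.ofReal_inv_of_pos hG, ← hg x hx, ofReal_norm]

theorem surfaceArea_ne_top (hV : ContinuousOn V X) (hcc' : c < c')
    (hc' : IsCompact (subLevel X V c'))
    (hreg : ∀ x ∈ levelSurface X V c, X ∈ 𝓝 x ∧ ContDiffAt ℝ 1 V x ∧ ∇ V x ≠ 0) :
    surfaceArea X V c ≠ ∞ := by
  have hlevel := isCompact_levelSurface hV hcc'.le hc'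
  have hgrad : ContinuousOn (∇ V) (levelSurface X V c) := fun x hx =>
    ((InnerProductSpace.toDual ℝ _).symm.continuous.continuousAt.comp
      ((hreg x hx).2.1.continuousAt_fderiv one_ne_zero)).continuousWithinAt
  obtain ⟨M, hM⟩ := hlevel.exists_bound_of_continuousOn hgrad
  have hone : ∀ x ∈ levelSurface X V c, 1 ≤ ENNReal.ofReal M * ‖∇ V x‖ₑ⁻¹ := fun x hx => by
    rw [← div_eq_mul_inv, ENNReal.le_div_iff_mul_le (Or.inl (by simpa using (hreg x hx).2.2))
      (Or.inl enorm_ne_top), one_mul, ← ofReal_norm]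
    exact ENNReal.ofReal_le_ofReal (hM x hx)
  rw [surfaceArea, ← setLIntegral_one]
  refine ne_top_of_le_ne_top ?_ (setLIntegral_mono' hlevel.measurableSet hone)
  rw [lintegral_const_mul' _ _ ENNReal.ofReal_ne_top]
  exact ENNReal.mul_ne_top ENNReal.ofReal_ne_top
    (tendsto_volume_inter_preimage_uIoc_div hV hcc' hc' hreg).1

end RegularLevel

section Rademacher

variable {d : ℕ} {X : Set (EuclideanSpace ℝ (Fin d))} {V : EuclideanSpace ℝ (Fin d) → ℝ}

theorem ae_exists_hasGradientWithinAt {K : ℝ≥0} (hV : LipschitzOnWith K V X)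
    (hX : MeasurableSet X) : ∀ᵐ x ∂volume.restrict X, ∃ g, HasGradientWithinAt V g X x := by
  filter_upwards [ae_restrict_of_ae hV.ae_differentiableWithinAt_of_mem, ae_restrict_mem hX]
    with x hx hxX
  exact ⟨_, (hx hxX).hasFDerivWithinAt.hasGradientWithinAt⟩

theorem ae_exists_hasGradientWithinAt_le_norm {K : ℝ≥0} (hV : LipschitzOnWith K V X)
    (hX : MeasurableSet X) {S : Set (EuclideanSpace ℝ (Fin d))} (hS : S ⊆ X) {G : ℝ}
    (hg : ∀ᵐ x ∂volume.restrict S, ∀ g, HasGradientWithinAt V g X x → G ≤ ‖g‖) :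
    ∀ᵐ x ∂volume.restrict S, ∃ g, HasGradientWithinAt V g X x ∧ G ≤ ‖g‖ := by
  filter_upwards [hg, ae_restrict_of_ae_restrict_of_subset hS (ae_exists_hasGradientWithinAt hV hX)]
    with x hgx ⟨g, hgX⟩
  exact ⟨g, hgX, hgx g hgX⟩

end Rademacher

theorem mainTheorem2_general {d : ℕ} {X : Set (EuclideanSpace ℝ (Fin d))} (hX : MeasurableSet X)
    {V : EuclideanSpace ℝ (Fin d) → ℝ} (hV : ContinuousOn V X) {G : ℝ} (hG : 0 < G) :
    (∀ a b : ℝ,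
      (∀ᵐ x ∂volume.restrict (subLevel X V b \ subLevel X V a),
        ∃ g, HasGradientWithinAt V g X x ∧ G ≤ ‖g‖) →
      (∀ s t : ℝ, a ≤ s → t ≤ b →
        volume (subLevel X V t \ subLevel X V s) ≤
          ENNReal.ofReal G⁻¹ * ∫⁻ r in Set.Ioc s t, surfaceArea X V r) ∧
      (0 ≤ a → volume (subLevel X V b) ≠ ∞ →
        ∀ᵐ c ∂volume.restrict (Set.Ioo a b), GrowthBoundAt X V G c)) ∧
    (∀ c : ℝ, 0 < c → (∃ c', c < c' ∧ IsCompact (subLevel X V c')) →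
      (∀ x ∈ levelSurface X V c, X ∈ 𝓝 x ∧ ContDiffAt ℝ 1 V x) →
      (∀ x ∈ levelSurface X V c, G ≤ ‖∇ V x‖) →
      surfaceArea X V c ≠ ∞ ∧ GrowthBoundAt X V G c ∧
      ((∀ x ∈ levelSurface X V c, ‖∇ V x‖ = G) →
        HasDerivAt (fun t => volume.real (subLevel X V t))
          (G⁻¹ * (surfaceArea X V c).toReal) c)) := by
  refine ⟨fun a b hg => ?_, ?_⟩
  · simp only [subLevel_sdiff_subLevel] at hg ⊢
    refine ⟨fun s t has htb => ?_, fun ha hfin => ae_growthBoundAt hX hV hG ha hg hfin⟩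
    refine volume_inter_preimage_le_lintegral_surfaceArea hX hV hG measurableSet_Ioc
      (ae_restrict_of_ae_restrict_of_subset ?_ hg)
    gcongr
  · rintro c hc ⟨c', hcc', hc'⟩ hreg hgrad
    have hreg' : ∀ x ∈ levelSurface X V c, X ∈ 𝓝 x ∧ ContDiffAt ℝ 1 V x ∧ ∇ V x ≠ 0 := fun x hx =>
      ⟨(hreg x hx).1, (hreg x hx).2, norm_pos_iff.1 (hG.trans_le (hgrad x hx))⟩
    have hm := (isCompact_levelSurface hV hcc'.le hc').measurableSet
    have hder := hasDerivAt_measureReal_subLevel hX hV hcc' hc' hreg'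
    refine ⟨surfaceArea_ne_top hV hcc' hc' hreg',
      growthBoundAt_of_hasDerivAt hX hV hG hc hcc' hc'.measure_ne_top hder
        (ENNReal.ofReal_toReal_le.trans (lintegral_inv_enorm_gradient_le hm hG hgrad)),
      fun heq => ?_⟩
    rwa [lintegral_inv_enorm_gradient_eq hm hG heq, ENNReal.toReal_mul,
      ENNReal.toReal_ofReal (inv_nonneg.2 hG.le)] at hder

end GrowthOfSublevelSets

theorem mainTheorem2 (d : ℕ) (hd : 1 ≤ d)
    (X : Set (EuclideanSpace ℝ (Fin d))) (hX : MeasurableSet X)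
    (V : EuclideanSpace ℝ (Fin d) → ℝ) (hpos : PosDefOn X V)
    (K : ℝ≥0) (hLip : LipschitzOnWith K V X)
    (G : ℝ) (hG : 0 < G) :
    -- Lipschitz `V` with gradient bounded below between two levels `a < b`
    -- (at almost every point, the gradient being taken where it exists)
    (∀ a b : ℝ, 0 ≤ a → a < b →
      (∀ᵐ x ∂volume.restrict (subLevel X V b \ subLevel X V a),
        ∀ g, HasGradientWithinAt V g X x → G ≤ ‖g‖) →
      (∀ s t : ℝ, a ≤ s → s ≤ t → t ≤ b →
        volume (subLevel X V t \ subLevel X V s) ≤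
          ENNReal.ofReal G⁻¹ * ∫⁻ r in Set.Ioc s t, surfaceArea X V r) ∧
      (volume (subLevel X V b) ≠ ∞ →
        ∀ᵐ c ∂volume.restrict (Set.Ioo a b), GrowthBoundAt X V G c)) ∧
    -- every single level `c` near which `V` is continuously differentiable
    (∀ c : ℝ, 0 < c → (∃ c', c < c' ∧ IsCompact (subLevel X V c')) →
      (∀ x ∈ levelSurface X V c, X ∈ 𝓝 x ∧ ContDiffAt ℝ 1 V x) →
      (∀ x ∈ levelSurface X V c, G ≤ ‖∇ V x‖) →
      surfaceArea X V c ≠ ∞ ∧ GrowthBoundAt X V G c ∧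
      ((∀ x ∈ levelSurface X V c, ‖∇ V x‖ = G) →
        HasDerivAt (fun t => volume.real (subLevel X V t))
          (G⁻¹ * (surfaceArea X V c).toReal) c)) := by
  obtain ⟨hannulus, hlevel⟩ := mainTheorem2_general hX hLip.continuousOn hG
  refine ⟨fun a b ha _ hg => ?_, hlevel⟩
  obtain ⟨hvol, hgrowth⟩ := hannulus a b <|
    ae_exists_hasGradientWithinAt_le_norm hLip hX (fun x hx => hx.1.1) hg
  exact ⟨fun s t has _ htb => hvol s t has htb, hgrowth ha⟩
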